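/- Let $G$ be a finite group and $p$ a prime dividing $|G|$. Write $I_p(G)$ for the set of elements of $G$ of order $p$. For $g\in G$ let $w_p(g)$ be the least integer $k\ge 0$ such that $g=x_1\cdots x_k$ with all $x_i\in I_p(G)$ (the empty product being $1$, and $w_p(g)=\infty$ if there is no such $k$), and let the $p$-width of $G$ be $w_p(G)=\max_{g\in G}w_p(g)$. **Proposition.** Let $q\ge 4$ be a prime power, let $G=PSL_2(q)$ be the quotient of $SL_2(\mathbb{F}_q)$ by its centre, and let $p$ be an odd prime dividing $|G|$. If $p=3$ and $q\geq 8$ is of the form $q=2^{2n+1}$ for some integer $n$, then $w_p(G)=3$. Otherwise $w_p(G)=2$. -/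

import Mathlib

section Width

open scoped Pointwise

/-- The width `w(g)` of an element `g` with respect to `S`: the least `k` such that
`g = s₁ ⋯ s_k` with all `s_i ∈ S`, and `⊤` if there is no such `k`.
Here `S ^ k` is the set of all products of `k` elements of `S`, with `S ^ 0 = {1}`. -/
noncomputable def elementWidth {G : Type*} [Group G] (S : Set G) (g : G) : ℕ∞ :=
  ⨅ (k : ℕ) (_ : g ∈ S ^ k), (k : ℕ∞)

/-- `width(G, S)`, the maximum of `w(g)` over `g ∈ G`, i.e. the diameter of the Cayley graph
of `G` with respect to `S`. -/
noncomputable def groupWidth {G : Type*} [Group G] (S : Set G) : ℕ∞ :=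
  ⨆ g : G, elementWidth S g

end Width

/-- `I_p(G)`, the set of elements of order `p`. -/
def elementsOfOrder (p : ℕ) (G : Type*) [Group G] : Set G :=
  {g | orderOf g = p}

/-- The `p`-width `w_p(G) = width(G, I_p(G))`. -/
noncomputable def pWidth (p : ℕ) (G : Type*) [Group G] : ℕ∞ :=
  groupWidth (elementsOfOrder p G)

/-!
The `p`-width of `PSL₂(F)` is computed with traces of two by two matrices of determinant one.

Nonscalar matrices of determinant one are conjugate under `GL₂(F)` exactly when their traces agree
(`exists_conj_of_trace_eq`), and for odd `p` the elements of order `p` of `PSL₂(F)` are the images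
of the matrices `X ≠ 1` with `X ^ p = 1`, a condition which among nonidentity matrices depends on
the trace only (`IsSLOrder.of_trace_eq`). So writing `A` as a product of two elements of order `p`
amounts to finding `X` and `Y` of suitable traces `t`, `s` with `tr (X Y) = tr A =: c` and `X Y`
nonscalar. If `t ≠ ±2`, putting `X` in companion form turns the first requirement into a point on a
conic with nondegenerate quadratic part, which exists over a finite field (`exists_conic_point`);
the second holds as soon as `t² + s² + c² - t s c - 4 ≠ 0`
(`trace_relation_of_mul_eq_smul_one`). For `s = t` this expression is `(c - 2) (c + 2 - t²)`. The
zero `c = t² - 2` is harmless, since `A` is then conjugate to `X²`. The zero `c = 2` is avoided in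
odd characteristic by passing from `A` to `-A`. If `p` is the characteristic, products of an upper
and a lower unipotent matrix serve instead.

There remain the involutions in characteristic two. For `p ≠ 3` the two distinct traces `t` and `t²`
can be used. For `p = 3` the only trace available is `1`, and an involution is a product of two
elements of order three precisely when `F` contains a primitive cube root of unity
(`exists_eq_mul_of_char_two_of_cube_root`, `exists_cube_root_of_involution_eq_mul`), that is, when
`|F|` is an even power of two. Otherwise three factors are needed, and they suffice, because an
involution is the product of an element of trace `1` and one of trace `s ≠ 0, 1`. In all cases an
involution has width at least two, as `p` is odd.
-/

open scoped Pointwise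

open Matrix

/-! ### Determinant-one matrices of size two -/

theorem det_fin_two_smul_one {K : Type*} [Field K] (r : K) :
    (r • (1 : Matrix (Fin 2) (Fin 2) K)).det = r ^ 2 := by
  simp

theorem trace_fin_two_smul_one {K : Type*} [Field K] (r : K) :
    (r • (1 : Matrix (Fin 2) (Fin 2) K)).trace = 2 * r := by
  simp [mul_comm]

/-- The Cayley-Hamilton identity for a two by two matrix of determinant one. -/
theorem mul_self_of_det_eq_one {K : Type*} [Field K] {A : Matrix (Fin 2) (Fin 2) K}
    (hA : A.det = 1) : A * A = A.trace • A - 1 := by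
  rw [det_fin_two] at hA
  ext i j
  fin_cases i <;> fin_cases j <;>
    simp [Matrix.mul_apply, Fin.sum_univ_two, trace_fin_two] <;>
    first | ring1 | linear_combination -hA

theorem trace_mul_self_of_det_eq_one {K : Type*} [Field K] {A : Matrix (Fin 2) (Fin 2) K}
    (hA : A.det = 1) : (A * A).trace = A.trace ^ 2 - 2 := by
  rw [mul_self_of_det_eq_one hA]
  simp [sq]

/-- A nonscalar matrix is similar to the companion matrix of its characteristic polynomial. The
similarity has columns `v` and `A v` for a vector `v` that is not an eigenvector. -/
theorem exists_mul_eq_mul_companion {K : Type*} [Field K] {A : Matrix (Fin 2) (Fin 2) K}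
    (hA : ∀ r : K, A ≠ r • 1) :
    ∃ P : Matrix (Fin 2) (Fin 2) K, P.det ≠ 0 ∧ A * P = P * !![0, -A.det; 1, A.trace] := by
  have key : ∀ x y : K,
      A * !![x, A 0 0 * x + A 0 1 * y; y, A 1 0 * x + A 1 1 * y] =
        !![x, A 0 0 * x + A 0 1 * y; y, A 1 0 * x + A 1 1 * y] * !![0, -A.det; 1, A.trace] := by
    intro x y
    rw [det_fin_two, trace_fin_two]
    ext i j
    fin_cases i <;> fin_cases j <;> simp [Matrix.mul_apply, Fin.sum_univ_two] <;> ring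
  by_cases h10 : A 1 0 = 0
  · by_cases h01 : A 0 1 = 0
    · refine ⟨_, ?_, key 1 1⟩
      intro h
      refine hA (A 0 0) ?_
      have h11 : A 1 1 = A 0 0 := by
        simp [det_fin_two, h10, h01] at h
        linear_combination h
      ext i j
      fin_cases i <;> fin_cases j <;> simp [h10, h01, h11]
    · exact ⟨_, by simpa [det_fin_two] using h01, key 0 1⟩
  · exact ⟨_, by simpa [det_fin_two] using h10, key 1 0⟩

/-- Two nonscalar matrices with the same trace and determinant are similar. -/
theorem exists_conj_of_trace_eq {K : Type*} [Field K] {A B : Matrix (Fin 2) (Fin 2) K}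
    (hA : ∀ r : K, A ≠ r • 1) (hB : ∀ r : K, B ≠ r • 1) (hdet : A.det = B.det)
    (htr : A.trace = B.trace) : ∃ P : GL (Fin 2) K, A = P.val * B * P⁻¹.val := by
  obtain ⟨P, hP, hAP⟩ := exists_mul_eq_mul_companion hA
  obtain ⟨Q, hQ, hBQ⟩ := exists_mul_eq_mul_companion hB
  rw [hdet, htr] at hAP
  lift P to GL (Fin 2) K using (Matrix.isUnit_iff_isUnit_det P).2 hP.isUnit
  lift Q to GL (Fin 2) K using (Matrix.isUnit_iff_isUnit_det Q).2 hQ.isUnit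
  refine ⟨P * Q⁻¹, ?_⟩
  rw [Units.eq_mul_inv_iff_mul_eq, Units.val_mul, ← mul_assoc, hAP, mul_assoc, mul_assoc]
  congr 1
  rw [Units.eq_inv_mul_iff_mul_eq, ← mul_assoc, ← hBQ, mul_assoc, Units.mul_inv, mul_one]

/-- In determinant one, the powers of a matrix are linear combinations of the matrix and the
identity whose coefficients depend on the trace only. -/
theorem exists_pow_eq_smul_add_smul {K : Type*} [Field K] (t : K) (n : ℕ) :
    ∃ a b : K, ∀ A : Matrix (Fin 2) (Fin 2) K, A.det = 1 → A.trace = t →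
      A ^ n = a • A + b • 1 := by
  induction n with
  | zero => exact ⟨0, 1, fun A _ _ => by simp⟩
  | succ n ih =>
    obtain ⟨a, b, h⟩ := ih
    refine ⟨a * t + b, -a, fun A hA ht => ?_⟩
    rw [pow_succ, h A hA ht, add_mul, smul_mul_assoc, mul_self_of_det_eq_one hA, ht,
      smul_mul_assoc, one_mul]
    module

theorem pow_eq_one_of_trace_eq {K : Type*} [Field K] {A B : Matrix (Fin 2) (Fin 2) K} {n : ℕ}
    (hA : A.det = 1) (hns : ∀ r : K, A ≠ r • 1) (hn : A ^ n = 1)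
    (hB : B.det = 1) (htr : B.trace = A.trace) : B ^ n = 1 := by
  obtain ⟨a, b, h⟩ := exists_pow_eq_smul_add_smul A.trace n
  have h1 := h A hA rfl
  rw [hn] at h1
  have ha : a = 0 := by
    by_contra ha
    refine hns (a⁻¹ * (1 - b)) ?_
    have : a • A = (1 - b) • 1 := by rw [sub_smul, one_smul]; exact eq_sub_of_add_eq h1.symm
    rw [mul_smul, ← this, smul_smul, inv_mul_cancel₀ ha, one_smul]
  rw [ha, zero_smul] at h1
  rw [h B hB htr, ha, zero_smul, ← h1]

/-- Powers of a matrix with the double eigenvalue `e = ± 1`. -/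
theorem pow_succ_of_trace_eq_two_mul {K : Type*} [Field K] {A : Matrix (Fin 2) (Fin 2) K} {e : K}
    (he : e ^ 2 = 1) (hA : A.det = 1) (htr : A.trace = 2 * e) (n : ℕ) :
    A ^ (n + 1) = ((n + 1 : ℕ) * e ^ n) • A - (n * e ^ (n + 1)) • 1 := by
  induction n with
  | zero => simp
  | succ n ih =>
    rw [pow_succ, ih, sub_mul, smul_mul_assoc, mul_self_of_det_eq_one hA, htr,
      smul_mul_assoc, one_mul]
    have : e ^ (n + 2) = e ^ n := by rw [pow_add, he, mul_one]
    rw [this]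
    push_cast
    module

/-! ### Matrices of odd prime order -/

/-- For `p` prime, `X` is an element of order `p` of `SL₂(K)`, stated for the underlying matrix so
that it can be conjugated by elements of `GL₂(K)`. -/
structure IsSLOrder {K : Type*} [Field K] (p : ℕ) (X : Matrix (Fin 2) (Fin 2) K) : Prop where
  det_eq : X.det = 1
  pow_eq : X ^ p = 1
  ne_one : X ≠ 1

namespace IsSLOrder

variable {K : Type*} [Field K] {p : ℕ} {X : Matrix (Fin 2) (Fin 2) K}

theorem ne_smul_one (hX : IsSLOrder p X) (hodd : Odd p) (r : K) : X ≠ r • 1 := by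
  rintro rfl
  have h2 : r ^ 2 = 1 := by rw [← det_fin_two_smul_one]; exact hX.det_eq
  have hp : r ^ p = 1 := by
    have := congrArg (fun M : Matrix (Fin 2) (Fin 2) K => M 0 0) hX.pow_eq
    simpa [smul_pow] using this
  obtain ⟨k, rfl⟩ := hodd
  rw [pow_succ, pow_mul, h2, one_pow, one_mul] at hp
  exact hX.ne_one (by rw [hp, one_smul])

theorem conj (hX : IsSLOrder p X) (P : GL (Fin 2) K) :
    IsSLOrder p (P.val * X * P⁻¹.val) where
  det_eq := by
    rw [det_mul, det_mul, hX.det_eq, mul_one, ← det_mul, Units.mul_inv, det_one]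
  pow_eq := by
    rw [Units.conj_pow, hX.pow_eq, mul_one, Units.mul_inv]
  ne_one h := hX.ne_one <| by
    have hX' : X = P⁻¹.val * (P.val * X * P⁻¹.val) * P.val := by
      rw [mul_assoc, mul_assoc, mul_assoc, Units.inv_mul, mul_one, ← mul_assoc, Units.inv_mul,
        one_mul]
    rw [hX', h, mul_one, Units.inv_mul]

/-- Having order `p` depends on the trace only, apart from the identity matrix. -/
theorem of_trace_eq (hX : IsSLOrder p X) (hodd : Odd p) {Y : Matrix (Fin 2) (Fin 2) K}
    (hY : Y.det = 1) (htr : Y.trace = X.trace) (h1 : Y ≠ 1) : IsSLOrder p Y :=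
  ⟨hY, pow_eq_one_of_trace_eq hX.det_eq (hX.ne_smul_one hodd) hX.pow_eq hY htr, h1⟩

theorem mul_self (hX : IsSLOrder p X) (hodd : Odd p) : IsSLOrder p (X * X) where
  det_eq := by rw [det_mul, hX.det_eq, mul_one]
  pow_eq := by rw [← sq, pow_right_comm, hX.pow_eq, one_pow]
  ne_one h := hX.ne_one <| by
    obtain ⟨k, rfl⟩ := hodd
    have := hX.pow_eq
    rwa [pow_succ, pow_mul, sq, h, one_pow, one_mul] at this

/-- Away from the characteristic an element of order `p` is not unipotent up to sign. -/
theorem trace_sq_ne_four (hX : IsSLOrder p X) (hodd : Odd p) (hp : (p : K) ≠ 0) :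
    X.trace ^ 2 ≠ 4 := by
  intro h
  obtain ⟨e, he, htr⟩ : ∃ e : K, e ^ 2 = 1 ∧ X.trace = 2 * e := by
    have : (X.trace - 2) * (X.trace + 2) = 0 := by linear_combination h
    rcases mul_eq_zero.1 this with h | h
    · exact ⟨1, by ring, by linear_combination h⟩
    · exact ⟨-1, by ring, by linear_combination h⟩
  have he0 : e ≠ 0 := by rintro rfl; simp at he
  obtain ⟨n, rfl⟩ : ∃ n, p = n + 1 := ⟨p - 1, (Nat.succ_pred_eq_of_pos hodd.pos).symm⟩
  have hpow := pow_succ_of_trace_eq_two_mul he hX.det_eq htr n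
  rw [hX.pow_eq, eq_sub_iff_add_eq] at hpow
  have hc : ((n + 1 : ℕ) * e ^ n : K) ≠ 0 := mul_ne_zero hp (pow_ne_zero _ he0)
  refine hX.ne_smul_one hodd (((n + 1 : ℕ) * e ^ n : K)⁻¹ * (1 + n * e ^ (n + 1))) ?_
  rw [mul_smul, add_smul, one_smul, hpow, smul_smul, inv_mul_cancel₀ hc, one_smul]

theorem trace_ne_zero (hX : IsSLOrder p X) (hodd : Odd p) : X.trace ≠ 0 := by
  intro h
  have h1 := (hX.mul_self hodd).ne_smul_one hodd (-1)
  rw [mul_self_of_det_eq_one hX.det_eq, h, zero_smul, zero_sub, neg_smul, one_smul] at h1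
  exact h1 rfl

end IsSLOrder

/-! ### Prescribing the traces of two matrices and of their product -/

/-- A conic over a finite field whose quadratic part `d² + t a d + a²` is nondegenerate has a
point. -/
theorem exists_conic_point {F : Type*} [Field F] [Finite F] {t : F} (ht : t ^ 2 ≠ 4) (m n k : F) :
    ∃ a d : F, d ^ 2 + d * (m + t * a) + a ^ 2 + n * a + k = 0 := by
  have := Fintype.ofFinite F
  by_cases h2 : (2 : F) = 0
  · -- In characteristic two, choose `a` to kill the coefficient of `d` and take a square root.
    have h4 : (4 : F) = 0 := by linear_combination 2 * h2
    have ht0 : t ≠ 0 := by rintro rfl; exact ht (by rw [h4]; ring)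
    have : CharP F 2 := CharTwo.of_one_ne_zero_of_two_eq_zero one_ne_zero h2
    obtain ⟨d, hd⟩ := FiniteField.isSquare_of_char_two (ringChar.eq_iff.2 this)
      (-((-m / t) ^ 2 + n * (-m / t) + k))
    refine ⟨-m / t, d, ?_⟩
    have : t * (-m / t) = -m := by field_simp
    rw [this]
    linear_combination -hd
  · -- In odd characteristic, complete the square in `d`.
    have hchar : ringChar F ≠ 2 := fun h => h2 (by
      have := ringChar.Nat.cast_ringChar (R := F)
      rw [h] at this
      exact_mod_cast this)
    have hlead : 1 - t ^ 2 / 4 ≠ 0 := by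
      intro h
      have h4 : (4 : F) ≠ 0 := by
        rw [show (4 : F) = 2 * 2 by norm_num]
        exact mul_ne_zero h2 h2
      field_simp at h
      exact ht (by linear_combination -h)
    obtain ⟨x, a, h⟩ := FiniteField.exists_root_sum_quadratic
      (f := Polynomial.C 1 * Polynomial.X ^ 2 + Polynomial.C 0 * Polynomial.X + Polynomial.C 0)
      (g := Polynomial.C (1 - t ^ 2 / 4) * Polynomial.X ^ 2 +
        Polynomial.C (n - t * m / 2) * Polynomial.X + Polynomial.C (k - m ^ 2 / 4))
      (Polynomial.degree_quadratic one_ne_zero) (Polynomial.degree_quadratic hlead)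
      (FiniteField.odd_card_of_char_ne_two hchar)
    refine ⟨a, x - (t * a + m) / 2, ?_⟩
    simp only [Polynomial.eval_add, Polynomial.eval_mul, Polynomial.eval_pow, Polynomial.eval_C,
      Polynomial.eval_X] at h
    have h4 : (4 : F) = 2 * 2 := by norm_num
    rw [h4] at h
    field_simp at h ⊢
    linear_combination h

/-- Over a finite field there are matrices of determinant one with prescribed traces `t`, `s` whose
product has prescribed trace `c`, provided that `t ≠ ±2`. -/
theorem exists_trace_triple {F : Type*} [Field F] [Finite F] {t : F} (ht : t ^ 2 ≠ 4) (s c : F) :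
    ∃ X Y : Matrix (Fin 2) (Fin 2) F, X.det = 1 ∧ Y.det = 1 ∧ X.trace = t ∧ Y.trace = s ∧
      (X * Y).trace = c := by
  obtain ⟨a, d, h⟩ := exists_conic_point ht (c - t * s) (-s) 1
  refine ⟨!![0, -1; 1, t], !![a, c + d - t * (s - a); d, s - a], ?_, ?_, ?_, ?_, ?_⟩
  · simp [det_fin_two]
  · rw [det_fin_two_of]
    linear_combination -h
  · simp [trace_fin_two]
  · simp [trace_fin_two]
  · simp [trace_fin_two]

/-- If the product of two matrices of determinant one is scalar, then their traces satisfy the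
equation of Fricke and Klein for a commuting pair. -/
theorem trace_relation_of_mul_eq_smul_one {K : Type*} [Field K] {X Y : Matrix (Fin 2) (Fin 2) K}
    (hX : X.det = 1) (hY : Y.det = 1) {r : K} (h : X * Y = r • 1) :
    X.trace ^ 2 + Y.trace ^ 2 + (X * Y).trace ^ 2 - X.trace * Y.trace * (X * Y).trace - 4 = 0 := by
  have hr : r ^ 2 = 1 := by rw [← det_fin_two_smul_one, ← h, det_mul, hX, hY, one_mul]
  have hXY : Y = r • X.adjugate := by
    calc Y = X.adjugate * (X * Y) := by rw [← mul_assoc, adjugate_mul, hX, one_smul, one_mul]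
      _ = _ := by rw [h, mul_smul_comm, mul_one]
  have htr : Y.trace = r * X.trace := by
    rw [hXY, adjugate_fin_two]
    simp [trace_fin_two]
    ring
  rw [htr, h, trace_fin_two_smul_one]
  linear_combination (4 - X.trace ^ 2) * hr

/-- A nonscalar matrix `A` of determinant one is a product of two matrices with prescribed traces
`t` and `s`, provided that `t ≠ ±2` and that the traces do not satisfy the equation for a commuting
pair. -/
theorem exists_eq_mul_of_trace {F : Type*} [Field F] [Finite F] {t s : F} (ht : t ^ 2 ≠ 4)
    {A : Matrix (Fin 2) (Fin 2) F} (hA : A.det = 1) (hns : ∀ r : F, A ≠ r • 1)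
    (hne : t ^ 2 + s ^ 2 + A.trace ^ 2 - t * s * A.trace - 4 ≠ 0) :
    ∃ X Y : Matrix (Fin 2) (Fin 2) F, A = X * Y ∧ X.det = 1 ∧ Y.det = 1 ∧ X.trace = t ∧
      Y.trace = s := by
  obtain ⟨X, Y, hX, hY, hXt, hYs, hXY⟩ := exists_trace_triple ht s A.trace
  obtain ⟨P, hP⟩ := exists_conj_of_trace_eq hns (B := X * Y)
    (fun r hr => hne (by
      have := trace_relation_of_mul_eq_smul_one hX hY hr
      rwa [hXt, hYs, hXY] at this))
    (by rw [hA, det_mul, hX, hY, mul_one]) hXY.symm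
  have hdet : P.val.det * P⁻¹.val.det = 1 := by rw [← det_mul, Units.mul_inv, det_one]
  refine ⟨P.val * X * P⁻¹.val, P.val * Y * P⁻¹.val, ?_, ?_, ?_, ?_, ?_⟩
  · rw [hP]
    simp only [mul_assoc, Units.inv_mul_cancel_left]
  · rw [det_mul, det_mul, hX, mul_one, hdet]
  · rw [det_mul, det_mul, hY, mul_one, hdet]
  · rw [trace_mul_comm, ← mul_assoc, Units.inv_mul, one_mul, hXt]
  · rw [trace_mul_comm, ← mul_assoc, Units.inv_mul, one_mul, hYs]

/-! ### Products of two matrices of order `p` -/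

/-- A nonscalar matrix with the trace of a nonscalar product `X Y` of elements of order `p` is
conjugate to it, hence is itself such a product. -/
theorem exists_eq_mul_of_trace_eq {K : Type*} [Field K] {p : ℕ} {A X Y : Matrix (Fin 2) (Fin 2) K}
    (hA : A.det = 1) (hns : ∀ r : K, A ≠ r • 1) (hX : IsSLOrder p X) (hY : IsSLOrder p Y)
    (hXY : ∀ r : K, X * Y ≠ r • 1) (htr : A.trace = (X * Y).trace) :
    ∃ X Y : Matrix (Fin 2) (Fin 2) K, IsSLOrder p X ∧ IsSLOrder p Y ∧ A = X * Y := by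
  obtain ⟨P, hP⟩ := exists_conj_of_trace_eq hns hXY
    (by rw [hA, det_mul, hX.det_eq, hY.det_eq, mul_one]) htr
  refine ⟨_, _, hX.conj P, hY.conj P, ?_⟩
  rw [hP]
  simp only [mul_assoc, Units.inv_mul_cancel_left]

/-- Factorization in terms of the traces of two given matrices of order `p`. -/
theorem IsSLOrder.exists_eq_mul {F : Type*} [Field F] [Finite F] {p : ℕ} (hodd : Odd p)
    {X Y A : Matrix (Fin 2) (Fin 2) F} (hX : IsSLOrder p X) (hY : IsSLOrder p Y)
    (hXt : X.trace ^ 2 ≠ 4) (hYt : Y.trace ^ 2 ≠ 4) (hA : A.det = 1) (hns : ∀ r : F, A ≠ r • 1)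
    (hne : X.trace ^ 2 + Y.trace ^ 2 + A.trace ^ 2 - X.trace * Y.trace * A.trace - 4 ≠ 0) :
    ∃ X Y : Matrix (Fin 2) (Fin 2) F, IsSLOrder p X ∧ IsSLOrder p Y ∧ A = X * Y := by
  obtain ⟨X', Y', h, hX', hY', hXt', hYt'⟩ := exists_eq_mul_of_trace hXt hA hns hne
  refine ⟨X', Y', hX.of_trace_eq hodd hX' hXt' ?_, hY.of_trace_eq hodd hY' hYt' ?_, h⟩
  · rintro rfl
    exact hXt (by rw [← hXt']; simp; norm_num)
  · rintro rfl
    exact hYt (by rw [← hYt']; simp; norm_num)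

theorem isSLOrder_upper_unipotent {K : Type*} [Field K] {p : ℕ} (hp : (p : K) = 0) :
    IsSLOrder p !![(1 : K), 1; 0, 1] where
  det_eq := by simp [det_fin_two]
  pow_eq := by
    have h : ∀ n : ℕ, !![(1 : K), 1; 0, 1] ^ n = !![1, (n : K); 0, 1] := by
      intro n
      induction n with
      | zero => simp [one_fin_two]
      | succ n ih => rw [pow_succ, ih]; simp [add_comm]
    rw [h, hp, one_fin_two]
  ne_one h := by simpa using congrFun (congrFun h 0) 1

/-- The case where `p` is the characteristic: every trace other than `2` is the trace of a product
of an upper and a lower unipotent matrix. -/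
theorem exists_eq_mul_of_char {K : Type*} [Field K] {p : ℕ} (hp : (p : K) = 0) (hodd : Odd p)
    {A : Matrix (Fin 2) (Fin 2) K} (hA : A.det = 1) (hns : ∀ r : K, A ≠ r • 1)
    (htr : A.trace ≠ 2) :
    ∃ X Y : Matrix (Fin 2) (Fin 2) K, IsSLOrder p X ∧ IsSLOrder p Y ∧ A = X * Y := by
  have hX := isSLOrder_upper_unipotent hp
  have hu : A.trace - 2 ≠ 0 := sub_ne_zero.2 htr
  have hY : IsSLOrder p !![1, 0; A.trace - 2, 1] := by
    refine hX.of_trace_eq hodd (by simp [det_fin_two]) (by simp [trace_fin_two]) fun h => hu ?_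
    simpa using congrFun (congrFun h 1) 0
  refine exists_eq_mul_of_trace_eq hA hns hX hY (fun r h => hu ?_) ?_
  · simpa using congrFun (congrFun h 1) 0
  · simp [trace_fin_two]
    ring

/-- Away from the characteristic, a matrix of trace other than `2` is a product of two matrices of
the same trace `t`: generically by `IsSLOrder.exists_eq_mul`, and as a square if its trace is
`t ^ 2 - 2`. -/
theorem exists_eq_mul_of_trace_ne_two {F : Type*} [Field F] [Finite F] {p : ℕ}
    (hp : (p : F) ≠ 0) (hodd : Odd p) {B A : Matrix (Fin 2) (Fin 2) F} (hB : IsSLOrder p B)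
    (hA : A.det = 1) (hns : ∀ r : F, A ≠ r • 1) (htr : A.trace ≠ 2) :
    ∃ X Y : Matrix (Fin 2) (Fin 2) F, IsSLOrder p X ∧ IsSLOrder p Y ∧ A = X * Y := by
  have ht := hB.trace_sq_ne_four hodd hp
  by_cases hc : A.trace = B.trace ^ 2 - 2
  · exact exists_eq_mul_of_trace_eq hA hns hB hB ((hB.mul_self hodd).ne_smul_one hodd)
      (by rw [hc, trace_mul_self_of_det_eq_one hB.det_eq])
  · refine hB.exists_eq_mul hodd hB ht ht hA hns ?_
    have := mul_ne_zero (sub_ne_zero.2 htr) (sub_ne_zero.2 hc)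
    contrapose! this
    linear_combination this

/-- In odd characteristic a nonscalar matrix is, up to sign, a product of two matrices of
order `p`. -/
theorem exists_eq_mul_or_neg_eq_mul {F : Type*} [Field F] [Finite F] {p : ℕ} (h2 : (2 : F) ≠ 0)
    (hodd : Odd p) {B A : Matrix (Fin 2) (Fin 2) F} (hB : IsSLOrder p B)
    (hA : A.det = 1) (hns : ∀ r : F, A ≠ r • 1) :
    ∃ X Y : Matrix (Fin 2) (Fin 2) F, IsSLOrder p X ∧ IsSLOrder p Y ∧
      (A = X * Y ∨ -A = X * Y) := by
  have main : ∀ C : Matrix (Fin 2) (Fin 2) F, C.det = 1 → (∀ r : F, C ≠ r • 1) → C.trace ≠ 2 →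
      ∃ X Y : Matrix (Fin 2) (Fin 2) F, IsSLOrder p X ∧ IsSLOrder p Y ∧ C = X * Y := by
    intro C hC hCns hCt
    by_cases hp : (p : F) = 0
    · exact exists_eq_mul_of_char hp hodd hC hCns hCt
    · exact exists_eq_mul_of_trace_ne_two hp hodd hB hC hCns hCt
  by_cases htr : A.trace = 2
  · obtain ⟨X, Y, hX, hY, h⟩ := main (-A) (by simp [det_neg, hA])
      (fun r hr => hns (-r) (by rw [neg_smul, ← hr, neg_neg])) (by
        rw [trace_neg, htr]
        intro h
        exact mul_ne_zero h2 h2 (by linear_combination -h))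
    exact ⟨X, Y, hX, hY, Or.inr h⟩
  · obtain ⟨X, Y, hX, hY, h⟩ := main A hA hns htr
    exact ⟨X, Y, hX, hY, Or.inl h⟩

theorem natCast_ne_zero_of_odd {K : Type*} [Field K] (h2 : (2 : K) = 0) {p : ℕ} (hodd : Odd p) :
    (p : K) ≠ 0 := by
  obtain ⟨k, rfl⟩ := hodd
  push_cast
  rw [h2, zero_mul, zero_add]
  exact one_ne_zero

/-- In characteristic two, for `p ≠ 3`, the involutions are products of two elements of order `p`
of distinct traces `t` and `t ^ 2`. The other nonscalar matrices are covered by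
`exists_eq_mul_of_trace_ne_two`. -/
theorem exists_eq_mul_of_char_two_of_ne_three {F : Type*} [Field F] [Finite F] {p : ℕ}
    (h2 : (2 : F) = 0) (hprime : p.Prime) (hodd : Odd p) (h3 : p ≠ 3)
    {B A : Matrix (Fin 2) (Fin 2) F} (hB : IsSLOrder p B) (hA : A.det = 1)
    (hns : ∀ r : F, A ≠ r • 1) :
    ∃ X Y : Matrix (Fin 2) (Fin 2) F, IsSLOrder p X ∧ IsSLOrder p Y ∧ A = X * Y := by
  have hp := natCast_ne_zero_of_odd h2 hodd
  by_cases htr : A.trace = 2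
  · have hB2 := hB.mul_self hodd
    refine hB.exists_eq_mul hodd hB2 (hB.trace_sq_ne_four hodd hp)
      (hB2.trace_sq_ne_four hodd hp) hA hns ?_
    rw [htr, trace_mul_self_of_det_eq_one hB.det_eq, h2]
    have h4 : (4 : F) = 0 := by linear_combination 2 * h2
    rw [h4]
    have ht1 : B.trace + 1 ≠ 0 := by
      intro h
      -- Trace `-1` forces `B ^ 2 + B + 1 = 0`, hence order three.
      have hBB := mul_self_of_det_eq_one hB.det_eq
      rw [eq_neg_of_add_eq_zero_left h, neg_smul, one_smul] at hBB
      have hB3 : B ^ 3 = 1 := by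
        rw [pow_succ, sq, hBB, sub_mul, neg_mul, hBB, one_mul]
        abel
      have : orderOf B ∣ 3 := orderOf_dvd_of_pow_eq_one hB3
      have hord : orderOf B = p := by
        have := Fact.mk hprime
        exact orderOf_eq_prime hB.pow_eq hB.ne_one
      rw [hord] at this
      exact h3 ((Nat.prime_dvd_prime_iff_eq hprime Nat.prime_three).1 this)
    have := mul_ne_zero (pow_ne_zero 2 (hB.trace_ne_zero hodd)) (pow_ne_zero 2 ht1)
    contrapose! this
    linear_combination this + B.trace ^ 3 * h2
  · exact exists_eq_mul_of_trace_ne_two hp hodd hB hA hns htr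

/-- In characteristic two, if `F` contains a primitive cube root of unity `w`, the involutions are
products of two elements of order three: both are triangular with diagonal entries `w`, `w⁻¹`. The
other nonscalar matrices are covered by `exists_eq_mul_of_trace_ne_two`. -/
theorem exists_eq_mul_of_char_two_of_cube_root {F : Type*} [Field F] [Finite F]
    (h2 : (2 : F) = 0) {w : F} (hw : w ^ 2 + w + 1 = 0) {A : Matrix (Fin 2) (Fin 2) F}
    (hA : A.det = 1) (hns : ∀ r : F, A ≠ r • 1) :
    ∃ X Y : Matrix (Fin 2) (Fin 2) F, IsSLOrder 3 X ∧ IsSLOrder 3 Y ∧ A = X * Y := by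
  have hodd : Odd 3 := by decide
  have hw0 : w ≠ 0 := by rintro rfl; simp at hw
  have hw1 : w ≠ 1 := by
    rintro rfl
    exact one_ne_zero (α := F) (by linear_combination hw - h2)
  have hw3 : w ^ 3 = 1 := by linear_combination (w - 1) * hw
  have hX : IsSLOrder 3 !![w, 0; 0, w ^ 2] := by
    refine ⟨by simp [det_fin_two]; linear_combination hw3, ?_, fun h => hw1 ?_⟩
    · have h6 : w ^ 6 = 1 := by linear_combination (w ^ 3 + 1) * hw3
      rw [pow_succ, sq, one_fin_two]
      simp
      exact ⟨by linear_combination hw3, by linear_combination h6⟩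
    · simpa using congrFun (congrFun h 0) 0
  by_cases htr : A.trace = 2
  · have hY : IsSLOrder 3 !![w ^ 2, 1; 0, w] := by
      refine hX.of_trace_eq hodd (by simp [det_fin_two]; linear_combination hw3)
        (by simp [trace_fin_two, add_comm]) fun h => hw1 ?_
      simpa using congrFun (congrFun h 1) 1
    refine exists_eq_mul_of_trace_eq hA hns hX hY (fun r h => hw0 ?_) ?_
    · simpa using congrFun (congrFun h 0) 1
    · rw [htr]
      simp [trace_fin_two]
      linear_combination -2 * hw3
  · exact exists_eq_mul_of_trace_ne_two (natCast_ne_zero_of_odd h2 hodd) hodd hX hA hns htr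

theorem isSLOrder_three_of_trace {K : Type*} [Field K] (h2 : (2 : K) = 0)
    {X : Matrix (Fin 2) (Fin 2) K} (hX : X.det = 1) (ht : X.trace = 1) : IsSLOrder 3 X where
  det_eq := hX
  pow_eq := by
    have hXX := mul_self_of_det_eq_one hX
    rw [ht, one_smul] at hXX
    have h : X ^ 3 = -1 := by
      rw [pow_succ, sq, hXX, sub_mul, hXX, one_mul]
      abel
    have : (-1 : K) = 1 := by linear_combination -h2
    rw [h, ← one_smul K (1 : Matrix (Fin 2) (Fin 2) K), ← neg_smul, this]
  ne_one h := by
    rw [h] at ht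
    simp at ht
    exact one_ne_zero (α := K) (by linear_combination h2 - ht)

/-- In characteristic two, if an involution is a product of two elements of order three, then the
field contains a primitive cube root of unity. -/
theorem exists_cube_root_of_involution_eq_mul {K : Type*} [Field K] (h2 : (2 : K) = 0)
    {X Y : Matrix (Fin 2) (Fin 2) K} (hX : IsSLOrder 3 X) (hY : IsSLOrder 3 Y)
    (h : !![(0 : K), 1; 1, 0] = X * Y) : ∃ w : K, w ^ 2 + w + 1 = 0 := by
  have hodd : Odd 3 := by decide
  -- The trace of an element of order three is `-1`.
  have htrace : ∀ {Z : Matrix (Fin 2) (Fin 2) K}, IsSLOrder 3 Z → Z.trace = -1 := by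
    intro Z hZ
    by_contra ht
    have hZ3 := hZ.pow_eq
    have hZZ := mul_self_of_det_eq_one hZ.det_eq
    rw [pow_succ, sq, hZZ, sub_mul, smul_mul_assoc, hZZ, one_mul] at hZ3
    have ht' : Z.trace + 1 ≠ 0 := fun h => ht (eq_neg_of_add_eq_zero_left h)
    have hZ' : (Z.trace + 1) • ((Z.trace - 1) • Z - 1) = 0 := by
      rw [← sub_eq_zero] at hZ3
      rw [← hZ3]
      module
    have h1 : (Z.trace - 1) • Z = 1 := by
      rcases smul_eq_zero.1 hZ' with h | h
      · exact absurd h ht'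
      · exact sub_eq_zero.1 h
    have h0 : Z.trace - 1 ≠ 0 := by intro h; rw [h, zero_smul] at h1; exact zero_ne_one h1
    exact hZ.ne_smul_one hodd (Z.trace - 1)⁻¹
      (by rw [← h1, smul_smul, inv_mul_cancel₀ h0, one_smul])
  have hXt := htrace hX
  have hYt := htrace hY
  have hXd := hX.det_eq
  have hYX : Y = X.adjugate * !![(0 : K), 1; 1, 0] := by
    rw [h, ← mul_assoc, adjugate_mul, hX.det_eq, one_smul, one_mul]
  rw [hYX, adjugate_fin_two] at hYt
  simp [trace_fin_two] at hYt
  rw [trace_fin_two] at hXt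
  rw [det_fin_two] at hXd
  refine ⟨X 0 0 + X 0 1, ?_⟩
  linear_combination -hXd + X 0 0 * hXt + X 0 1 * hYt +
    (X 0 0 * X 0 1 + X 0 1 ^ 2) * h2

/-! ### Widths -/

theorem elementWidth_le {G : Type*} [Group G] {S : Set G} {g : G} {k : ℕ} (h : g ∈ S ^ k) :
    elementWidth S g ≤ k :=
  iInf₂_le k h

theorem elementWidth_one {G : Type*} [Group G] (S : Set G) : elementWidth S (1 : G) = 0 := by
  have h : elementWidth S (1 : G) ≤ (0 : ℕ) := elementWidth_le (by simp)
  simpa using h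

theorem elementWidth_le_two_of_eq_mul {G : Type*} [Group G] {S : Set G} {g x y : G} (hx : x ∈ S)
    (hy : y ∈ S) (h : g = x * y) : elementWidth S g ≤ 2 :=
  elementWidth_le (k := 2) (by rw [sq, h]; exact Set.mul_mem_mul hx hy)

theorem two_le_elementWidth {G : Type*} [Group G] {S : Set G} {g : G} (h1 : g ≠ 1) (hS : g ∉ S) :
    2 ≤ elementWidth S g := by
  refine le_iInf₂ fun k hk => ?_
  match k with
  | 0 => exact absurd (by simpa using hk) h1
  | 1 => exact absurd (by simpa using hk) hS
  | k + 2 => exact_mod_cast Nat.le_add_left 2 k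

theorem three_le_elementWidth {G : Type*} [Group G] {S : Set G} {g : G} (h1 : g ≠ 1) (hS : g ∉ S)
    (hSS : ∀ x ∈ S, ∀ y ∈ S, g ≠ x * y) : 3 ≤ elementWidth S g := by
  refine le_iInf₂ fun k hk => ?_
  match k with
  | 0 => exact absurd (by simpa using hk) h1
  | 1 => exact absurd (by simpa using hk) hS
  | 2 =>
    rw [sq] at hk
    obtain ⟨x, hx, y, hy, h⟩ := Set.mem_mul.1 hk
    exact absurd h.symm (hSS x hx y hy)
  | k + 3 => exact_mod_cast Nat.le_add_left 3 k

/-! ### Elements of order `p` of the projective special linear group -/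

theorem mem_center_iff_eq_one_or_neg_one {K : Type*} [Field K]
    {A : Matrix.SpecialLinearGroup (Fin 2) K} :
    A ∈ Subgroup.center (Matrix.SpecialLinearGroup (Fin 2) K) ↔ A.val = 1 ∨ A.val = -1 := by
  rw [Matrix.SpecialLinearGroup.mem_center_iff]
  constructor
  · rintro ⟨r, hr, h⟩
    rw [Fintype.card_fin, sq_eq_one_iff] at hr
    rw [← h]
    rcases hr with rfl | rfl
    · exact Or.inl (map_one _)
    · exact Or.inr (by rw [map_neg, map_one])
  · rintro (h | h)
    · exact ⟨1, by simp, by rw [h, map_one]⟩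
    · exact ⟨-1, by simp, by rw [h, map_neg, map_one]⟩

theorem mem_center_of_eq_smul_one {K : Type*} [Field K]
    {A : Matrix.SpecialLinearGroup (Fin 2) K} {r : K}
    (h : A.val = r • 1) : A ∈ Subgroup.center (Matrix.SpecialLinearGroup (Fin 2) K) := by
  refine Matrix.SpecialLinearGroup.mem_center_iff.2 ⟨r, ?_, ?_⟩
  · rw [Fintype.card_fin, ← det_fin_two_smul_one, ← h, A.det_coe]
  · rw [h, smul_one_eq_diagonal]; rfl

theorem mk_mem_elementsOfOrder {K : Type*} [Field K] {p : ℕ} (hp : p.Prime) (hodd : Odd p)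
    {X : Matrix.SpecialLinearGroup (Fin 2) K} (hX : IsSLOrder p X.val) :
    (X : ProjectiveSpecialLinearGroup (Fin 2) K) ∈ elementsOfOrder p _ := by
  have := Fact.mk hp
  refine orderOf_eq_prime ?_ ?_
  · have : X ^ p = 1 := Subtype.ext (by simpa using hX.pow_eq)
    rw [← QuotientGroup.mk_pow, this, QuotientGroup.mk_one]
  · rw [Ne, QuotientGroup.eq_one_iff, mem_center_iff_eq_one_or_neg_one]
    have h1 := hX.ne_smul_one hodd 1
    have h2 := hX.ne_smul_one hodd (-1)
    rw [one_smul] at h1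
    rw [neg_smul, one_smul] at h2
    tauto

/-- As `p` is odd, one of the two lifts of an element of order `p` of `PSL₂(K)` has order `p`. -/
theorem exists_lift_of_mem_elementsOfOrder {K : Type*} [Field K] {p : ℕ} (hp : p.Prime)
    (hodd : Odd p) {g : ProjectiveSpecialLinearGroup (Fin 2) K} (hg : g ∈ elementsOfOrder p _) :
    ∃ X : Matrix.SpecialLinearGroup (Fin 2) K, IsSLOrder p X.val ∧ g = X := by
  obtain ⟨X, rfl⟩ := QuotientGroup.mk_surjective g
  replace hg : orderOf (X : ProjectiveSpecialLinearGroup (Fin 2) K) = p := hg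
  have hne : X ∉ Subgroup.center (Matrix.SpecialLinearGroup (Fin 2) K) := by
    intro h
    rw [(QuotientGroup.eq_one_iff X).2 h, orderOf_one] at hg
    exact hp.one_lt.ne hg
  rw [mem_center_iff_eq_one_or_neg_one, not_or] at hne
  have hpow : X ^ p ∈ Subgroup.center (Matrix.SpecialLinearGroup (Fin 2) K) := by
    rw [← QuotientGroup.eq_one_iff, QuotientGroup.mk_pow, ← hg, pow_orderOf_eq_one]
  rw [mem_center_iff_eq_one_or_neg_one, Matrix.SpecialLinearGroup.coe_pow] at hpow
  rcases hpow with h | h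
  · exact ⟨X, ⟨X.det_coe, h, hne.1⟩, rfl⟩
  · refine ⟨-X, ⟨(-X).det_coe, ?_, ?_⟩, ?_⟩
    · rw [Matrix.SpecialLinearGroup.coe_neg, hodd.neg_pow, h, neg_neg]
    · rw [Matrix.SpecialLinearGroup.coe_neg, Ne, neg_eq_iff_eq_neg]
      exact hne.2
    · rw [QuotientGroup.eq, mem_center_iff_eq_one_or_neg_one]
      right
      rw [mul_neg, inv_mul_cancel, Matrix.SpecialLinearGroup.coe_neg,
        Matrix.SpecialLinearGroup.coe_one]

theorem elementWidth_mk_le_two {K : Type*} [Field K] {p : ℕ} (hp : p.Prime) (hodd : Odd p)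
    {A : Matrix.SpecialLinearGroup (Fin 2) K} {X Y : Matrix (Fin 2) (Fin 2) K} (hX : IsSLOrder p X)
    (hY : IsSLOrder p Y) (h : A.val = X * Y ∨ -A.val = X * Y) :
    elementWidth (elementsOfOrder p (ProjectiveSpecialLinearGroup (Fin 2) K)) A ≤ 2 := by
  obtain ⟨X, rfl⟩ : ∃ X' : Matrix.SpecialLinearGroup (Fin 2) K, X'.val = X :=
    ⟨⟨X, hX.det_eq⟩, rfl⟩
  obtain ⟨Y, rfl⟩ : ∃ Y' : Matrix.SpecialLinearGroup (Fin 2) K, Y'.val = Y :=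
    ⟨⟨Y, hY.det_eq⟩, rfl⟩
  refine elementWidth_le_two_of_eq_mul (mk_mem_elementsOfOrder hp hodd hX)
    (mk_mem_elementsOfOrder hp hodd hY) ?_
  rw [← QuotientGroup.mk_mul]
  rcases h with h | h
  · rw [show A = X * Y from Subtype.ext h]
  · rw [QuotientGroup.eq, mem_center_iff_eq_one_or_neg_one]
    right
    rw [show X * Y = -A from Subtype.ext h.symm, mul_neg, inv_mul_cancel,
      Matrix.SpecialLinearGroup.coe_neg, Matrix.SpecialLinearGroup.coe_one]

theorem elementWidth_mk_of_mem_center {K : Type*} [Field K] {p : ℕ}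
    {A : Matrix.SpecialLinearGroup (Fin 2) K}
    (h : A ∈ Subgroup.center (Matrix.SpecialLinearGroup (Fin 2) K)) :
    elementWidth (elementsOfOrder p (ProjectiveSpecialLinearGroup (Fin 2) K)) A = 0 := by
  rw [(QuotientGroup.eq_one_iff A).2 h, elementWidth_one]

/-! ### The involution -/

/-- The matrix with rows `(0, 1)` and `(-1, 0)`, whose image in `PSL₂(K)` is an involution. -/
def weylElement (K : Type*) [Field K] : Matrix.SpecialLinearGroup (Fin 2) K :=
  ⟨!![0, 1; -1, 0], by simp [det_fin_two]⟩

theorem mk_weylElement_ne_one (K : Type*) [Field K] :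
    (weylElement K : ProjectiveSpecialLinearGroup (Fin 2) K) ≠ 1 := by
  rw [Ne, QuotientGroup.eq_one_iff, mem_center_iff_eq_one_or_neg_one]
  rintro (h | h) <;> simpa [weylElement] using congrFun (congrFun h 0) 1

theorem mk_weylElement_notMem_elementsOfOrder (K : Type*) [Field K] {p : ℕ} (hodd : Odd p) :
    (weylElement K : ProjectiveSpecialLinearGroup (Fin 2) K) ∉ elementsOfOrder p _ := by
  intro h
  have hsq : (weylElement K : ProjectiveSpecialLinearGroup (Fin 2) K) ^ 2 = 1 := by
    rw [← QuotientGroup.mk_pow, QuotientGroup.eq_one_iff, mem_center_iff_eq_one_or_neg_one]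
    right
    rw [Matrix.SpecialLinearGroup.coe_pow, sq]
    ext i j
    fin_cases i <;> fin_cases j <;> simp [weylElement]
  have hpow : (weylElement K : ProjectiveSpecialLinearGroup (Fin 2) K) ^ p = 1 := by
    have h' : orderOf (weylElement K : ProjectiveSpecialLinearGroup (Fin 2) K) = p := h
    rw [← h', pow_orderOf_eq_one]
  obtain ⟨k, rfl⟩ := hodd
  rw [pow_succ, pow_mul, hsq, one_pow, one_mul] at hpow
  exact mk_weylElement_ne_one K hpow

theorem two_le_pWidth (K : Type*) [Field K] {p : ℕ} (hodd : Odd p) :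
    2 ≤ pWidth p (ProjectiveSpecialLinearGroup (Fin 2) K) :=
  (two_le_elementWidth (mk_weylElement_ne_one K)
    (mk_weylElement_notMem_elementsOfOrder K hodd)).trans (le_iSup _ _)

/-! ### Cube roots of unity in characteristic two -/

theorem exists_cube_root_iff_three_dvd {F : Type*} [Field F] [Finite F] (h2 : (2 : F) = 0) :
    (∃ w : F, w ^ 2 + w + 1 = 0) ↔ 3 ∣ Nat.card F - 1 := by
  have h3 : (3 : F) ≠ 0 := fun h => one_ne_zero (α := F) (by linear_combination h - h2)
  have := Fact.mk Nat.prime_three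
  rw [← Nat.card_units]
  constructor
  · rintro ⟨w, hw⟩
    have hw0 : w ≠ 0 := by rintro rfl; simp at hw
    have h : orderOf (Units.mk0 w hw0) = 3 := by
      refine orderOf_eq_prime (Units.ext ?_) fun h => h3 ?_
      · simp only [Units.val_pow_eq_pow_val, Units.val_mk0, Units.val_one]
        linear_combination (w - 1) * hw
      · have : w = 1 := by simpa using congrArg Units.val h
        rw [this] at hw
        linear_combination hw
    rw [← h]
    exact orderOf_dvd_natCard _
  · intro h
    obtain ⟨w, hw⟩ := exists_prime_orderOf_dvd_card' 3 h
    have hw3 : (w : F) ^ 3 = 1 := by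
      rw [← Units.val_pow_eq_pow_val, ← hw, pow_orderOf_eq_one, Units.val_one]
    have hw1 : (w : F) - 1 ≠ 0 := by
      intro h
      have : w = 1 := Units.ext (sub_eq_zero.1 h)
      rw [this, orderOf_one] at hw
      omega
    refine ⟨w, mul_left_cancel₀ hw1 ?_⟩
    linear_combination hw3

theorem exists_card_eq_two_pow {F : Type*} [Field F] [Finite F] (h2 : (2 : F) = 0) :
    ∃ n : ℕ, Nat.card F = 2 ^ n := by
  have := Fintype.ofFinite F
  have : CharP F 2 := CharTwo.of_one_ne_zero_of_two_eq_zero one_ne_zero h2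
  obtain ⟨n, -, h⟩ := FiniteField.card F 2
  exact ⟨n, by rw [Nat.card_eq_fintype_card, h]⟩

theorem two_eq_zero_of_card_eq_two_pow {F : Type*} [Field F] [Finite F] {n : ℕ}
    (h : Nat.card F = 2 ^ n) : (2 : F) = 0 := by
  have := Fintype.ofFinite F
  have hc := FiniteField.cast_card_eq_zero F
  rw [← Nat.card_eq_fintype_card, h, Nat.cast_pow] at hc
  exact_mod_cast eq_zero_of_pow_eq_zero hc

/-! ### The width of the projective special linear group -/

/-- Every nonscalar matrix is, up to sign, a product of two matrices of order `p`, unless `p = 3`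
and the field has order `2 ^ (2 * n + 1)`. -/
theorem exists_eq_mul_of_not_exceptional {F : Type*} [Field F] [Finite F] {p : ℕ} (hp : p.Prime)
    (hodd : Odd p) {B A : Matrix (Fin 2) (Fin 2) F} (hB : IsSLOrder p B)
    (hexc : ¬((∃ n : ℕ, Nat.card F = 2 ^ (2 * n + 1)) ∧ p = 3))
    (hA : A.det = 1) (hns : ∀ r : F, A ≠ r • 1) :
    ∃ X Y : Matrix (Fin 2) (Fin 2) F, IsSLOrder p X ∧ IsSLOrder p Y ∧
      (A = X * Y ∨ -A = X * Y) := by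
  by_cases h2 : (2 : F) = 0
  · by_cases h3 : p = 3
    · subst h3
      have hdvd : 3 ∣ Nat.card F - 1 := by
        obtain ⟨n, hn⟩ := exists_card_eq_two_pow h2
        obtain ⟨m, rfl | rfl⟩ := n.even_or_odd'
        · rw [hn, pow_mul]
          exact Nat.sub_dvd_pow_sub_pow (2 ^ 2) 1 m |>.trans (by rw [one_pow])
        · exact absurd ⟨⟨m, hn⟩, rfl⟩ hexc
      obtain ⟨w, hw⟩ := (exists_cube_root_iff_three_dvd h2).2 hdvd
      obtain ⟨X, Y, hX, hY, h⟩ := exists_eq_mul_of_char_two_of_cube_root h2 hw hA hns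
      exact ⟨X, Y, hX, hY, Or.inl h⟩
    · obtain ⟨X, Y, hX, hY, h⟩ := exists_eq_mul_of_char_two_of_ne_three h2 hp hodd h3 hB hA hns
      exact ⟨X, Y, hX, hY, Or.inl h⟩
  · exact exists_eq_mul_or_neg_eq_mul h2 hodd hB hA hns

theorem pWidth_eq_two {F : Type*} [Field F] [Finite F] {p : ℕ} (hp : p.Prime) (hodd : Odd p)
    (hdvd : p ∣ Nat.card (ProjectiveSpecialLinearGroup (Fin 2) F))
    (hexc : ¬((∃ n : ℕ, Nat.card F = 2 ^ (2 * n + 1)) ∧ p = 3)) :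
    pWidth p (ProjectiveSpecialLinearGroup (Fin 2) F) = 2 := by
  have := Fact.mk hp
  obtain ⟨b, hb⟩ := exists_prime_orderOf_dvd_card' p hdvd
  obtain ⟨B, hB, -⟩ := exists_lift_of_mem_elementsOfOrder hp hodd hb
  refine le_antisymm (iSup_le fun g => ?_) (two_le_pWidth F hodd)
  obtain ⟨A, rfl⟩ := QuotientGroup.mk_surjective g
  by_cases hA : ∃ r : F, A.val = r • 1
  · obtain ⟨r, hr⟩ := hA
    rw [elementWidth_mk_of_mem_center (mem_center_of_eq_smul_one hr)]
    exact zero_le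
  · push Not at hA
    obtain ⟨X, Y, hX, hY, h⟩ := exists_eq_mul_of_not_exceptional hp hodd hB hexc A.det_coe hA
    exact elementWidth_mk_le_two hp hodd hX hY h

/-- An involution is the product of an element of order three and one of trace `s ≠ 0, 1`; the
latter is a product of two elements of order three. Two factors are not enough, as `F` contains no
primitive cube root of unity. -/
theorem pWidth_three_eq_three {F : Type*} [Field F] [Finite F] {n : ℕ}
    (hcard : Nat.card F = 2 ^ (2 * n + 1)) (h4 : 4 ≤ Nat.card F) :
    pWidth 3 (ProjectiveSpecialLinearGroup (Fin 2) F) = 3 := by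
  have h2 := two_eq_zero_of_card_eq_two_pow hcard
  have hodd : Odd 3 := by decide
  have h3 := natCast_ne_zero_of_odd h2 hodd
  have hneg : (-1 : F) = 1 := by linear_combination -h2
  have hB : IsSLOrder 3 !![(0 : F), 1; 1, 1] :=
    isSLOrder_three_of_trace h2 (by simp [det_fin_two, hneg]) (by simp [trace_fin_two])
  refine le_antisymm (iSup_le fun g => ?_) ?_
  · obtain ⟨A, rfl⟩ := QuotientGroup.mk_surjective g
    by_cases hA : ∃ r : F, A.val = r • 1
    · obtain ⟨r, hr⟩ := hA
      rw [elementWidth_mk_of_mem_center (mem_center_of_eq_smul_one hr)]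
      exact zero_le
    push Not at hA
    by_cases htr : A.val.trace = 2
    · obtain ⟨s, hs0, hs1⟩ : ∃ s : F, s ≠ 0 ∧ s ≠ 1 := by
        by_contra! h
        have : (Set.univ : Set F) ⊆ {0, 1} := fun x _ => by
          by_cases hx : x = 0
          · exact Or.inl hx
          · exact Or.inr (h x hx)
        have h' := Set.ncard_le_ncard this (Set.toFinite _)
        rw [Set.ncard_univ] at h'
        have := Set.ncard_insert_le (0 : F) {1}
        rw [Set.ncard_singleton] at this
        omega
      obtain ⟨X, Y, hAXY, hX, hY, hXt, hYt⟩ := exists_eq_mul_of_trace (t := 1) (s := s)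
        (by intro h; exact one_ne_zero (α := F) (by linear_combination h + 2 * h2))
        A.det_coe hA (by
          rw [htr, h2]
          intro h
          have : (1 + s) ^ 2 = 0 := by linear_combination h + (s + 2) * h2
          exact hs1 (by linear_combination (pow_eq_zero_iff two_ne_zero).1 this - h2))
      have hY2 : Y.trace ≠ 2 := by rwa [hYt, h2]
      have hYns : ∀ r : F, Y ≠ r • 1 := by
        rintro r rfl
        rw [trace_fin_two_smul_one, h2, zero_mul] at hYt
        exact hs0 hYt.symm
      obtain ⟨Y₁, Y₂, hY₁, hY₂, hYY⟩ := exists_eq_mul_of_trace_ne_two h3 hodd hB hY hYns hY2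
      refine elementWidth_le (k := 3) ?_
      obtain ⟨X, rfl⟩ : ∃ X' : Matrix.SpecialLinearGroup (Fin 2) F, X'.val = X :=
        ⟨⟨X, hX⟩, rfl⟩
      obtain ⟨Y₁, rfl⟩ : ∃ Y' : Matrix.SpecialLinearGroup (Fin 2) F, Y'.val = Y₁ :=
        ⟨⟨Y₁, hY₁.det_eq⟩, rfl⟩
      obtain ⟨Y₂, rfl⟩ : ∃ Y' : Matrix.SpecialLinearGroup (Fin 2) F, Y'.val = Y₂ :=
        ⟨⟨Y₂, hY₂.det_eq⟩, rfl⟩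
      rw [hYY, ← mul_assoc] at hAXY
      rw [show A = X * Y₁ * Y₂ from Subtype.ext hAXY, QuotientGroup.mk_mul, QuotientGroup.mk_mul,
        pow_succ, sq]
      exact Set.mul_mem_mul (Set.mul_mem_mul
        (mk_mem_elementsOfOrder Nat.prime_three hodd (isSLOrder_three_of_trace h2 hX hXt))
        (mk_mem_elementsOfOrder Nat.prime_three hodd hY₁))
        (mk_mem_elementsOfOrder Nat.prime_three hodd hY₂)
    · obtain ⟨X, Y, hX, hY, h⟩ := exists_eq_mul_of_trace_ne_two h3 hodd hB A.det_coe hA htr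
      exact (elementWidth_mk_le_two Nat.prime_three hodd hX hY (Or.inl h)).trans
        (by norm_num)
  · refine (three_le_elementWidth (mk_weylElement_ne_one F)
      (mk_weylElement_notMem_elementsOfOrder F hodd) fun x hx y hy h => ?_).trans (le_iSup _ _)
    obtain ⟨X, hX, rfl⟩ := exists_lift_of_mem_elementsOfOrder Nat.prime_three hodd hx
    obtain ⟨Y, hY, rfl⟩ := exists_lift_of_mem_elementsOfOrder Nat.prime_three hodd hy
    rw [← QuotientGroup.mk_mul, QuotientGroup.eq, mem_center_iff_eq_one_or_neg_one,
      show (-1 : Matrix (Fin 2) (Fin 2) F) = 1 by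
        rw [← one_smul F (1 : Matrix (Fin 2) (Fin 2) F), ← neg_smul, hneg], or_self] at h
    have hXY : weylElement F = X * Y := inv_mul_eq_one.1 (Subtype.ext h)
    have hroot : ∃ w : F, w ^ 2 + w + 1 = 0 := by
      refine exists_cube_root_of_involution_eq_mul h2 hX hY ?_
      rw [← Matrix.SpecialLinearGroup.coe_mul, ← hXY]
      simp only [weylElement, hneg]
    rw [exists_cube_root_iff_three_dvd h2, hcard, pow_succ, pow_mul] at hroot
    have hmod : (2 ^ 2) ^ n % 3 = 1 := by
      rw [Nat.pow_mod]
      simp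
    omega

theorem mainTheorem7 (F : Type*) [Field F] [Finite F] (q : ℕ) (hF : Nat.card F = q) (hq : 4 ≤ q)
    (p : ℕ) (hp : p.Prime) (hodd : Odd p)
    (hdvd : p ∣ Nat.card (Matrix.ProjectiveSpecialLinearGroup (Fin 2) F)) :
    (((8 ≤ q ∧ ∃ n : ℕ, q = 2 ^ (2 * n + 1)) ∧ p = 3) →
      pWidth p (Matrix.ProjectiveSpecialLinearGroup (Fin 2) F) = 3) ∧
    (¬((8 ≤ q ∧ ∃ n : ℕ, q = 2 ^ (2 * n + 1)) ∧ p = 3) →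
      pWidth p (Matrix.ProjectiveSpecialLinearGroup (Fin 2) F) = 2) := by
  subst hF
  constructor
  · rintro ⟨⟨-, n, hn⟩, rfl⟩
    exact pWidth_three_eq_three hn hq
  · intro h
    refine pWidth_eq_two hp hodd hdvd fun ⟨⟨n, hn⟩, h3⟩ => h ⟨⟨?_, n, hn⟩, h3⟩
    -- An odd power of two that is at least `4` is at least `8`.
    rw [hn] at hq ⊢
    rcases n with - | n
    · norm_num at hq
    · exact Nat.pow_le_pow_right (i := 3) two_pos (by omega)
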